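/- **Setting.** In $\mathrm{SRD}^\rho$ (symmetric rendezvous in a disk, $\rho>\sqrt2$) two robots start in the plane at Euclidean distance $2$ from each other, both at distance $\rho$ from a common reference point $O$. Each robot sees $O$ and knows $\rho$ and the initial distance $2$, but does not know where the other robot is, and the robots share neither a compass nor a sense of orientation. They move in the plane with speed at most $1$, follow the same randomized algorithm (which may depend on $\rho$) with independent private randomness, and detect each other only when they are at the same point; the rendezvous time is the first time this happens. The offline optimum of an instance is the least possible rendezvous time when both starting points are known. An algorithm is $c$-competitive if for every $\rho>\sqrt2$ and every initial placement its expected rendezvous time is at most $c$ times the offline optimum. It is $\delta$-effective if $\delta$ is the largest $\rho>\sqrt2$ for which its expected rendezvous time (worst case over placements) is at most $4.25$, and $0$-effective if there is no such $\rho$. **Theorem.** $\mathrm{SRD}^\rho$ admits an online algorithm which is $4.2574$-competitive and $0$-effective. -/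

import Mathlib

open MeasureTheory
open scoped NNReal ENNReal

noncomputable section

namespace SRD

/-- A trajectory in the plane `ℂ`, parametrized by time, of a robot whose speed is at most `1`. -/
def IsTrajectory (γ : ℝ≥0 → ℂ) : Prop := LipschitzWith 1 γ

/-- The rendezvous time of two robots: the first time they are at the same point (`∞` if never). -/
def meetingTime (γ₁ γ₂ : ℝ≥0 → ℂ) : ℝ≥0∞ :=
  ⨅ (t : ℝ≥0) (_ : γ₁ t = γ₂ t), (t : ℝ≥0∞)

/-- The offline optimum: the least rendezvous time that two robots starting at `p` and `q`
can achieve when the two starting points are known. -/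
def offlineOpt (p q : ℂ) : ℝ≥0∞ :=
  ⨅ (γ₁ : ℝ≥0 → ℂ) (γ₂ : ℝ≥0 → ℂ) (_ : IsTrajectory γ₁ ∧ γ₁ 0 = p)
    (_ : IsTrajectory γ₂ ∧ γ₂ 0 = q), meetingTime γ₁ γ₂

/-- A randomized strategy of one robot, given that the reference point is at distance `ρ`.
It is written in the robot's own coordinates: the reference point is `0`, the starting
point is `ρ`.  Until rendezvous a robot observes nothing, so a strategy is a random
trajectory.  `Ω` is the sample space of the private randomness of one robot. -/
structure Strategy (ρ : ℝ) where
  Ω : Type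
  [measurableSpace : MeasurableSpace Ω]
  law : Measure Ω
  [isProbabilityMeasure : IsProbabilityMeasure law]
  traj : Ω → ℝ≥0 → ℂ
  isTrajectory : ∀ ω, IsTrajectory (traj ω)
  start : ∀ ω, traj ω 0 = (ρ : ℂ)
  measurable : ∀ t, Measurable fun ω => traj ω t

attribute [instance] Strategy.measurableSpace Strategy.isProbabilityMeasure

/-- A placement of the two robots on the circle of radius `ρ` around the reference point `0`,
at Euclidean distance `2`.  A robot is given by the isometry fixing `0` that takes its own
coordinates to the plane (a rotation or a reflection: the robots share neither
a compass nor a notion of clockwise); its position is the image of `ρ`. -/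
structure Placement (ρ : ℝ) where
  frame₁ : ℂ ≃ₗᵢ[ℝ] ℂ
  frame₂ : ℂ ≃ₗᵢ[ℝ] ℂ
  dist_eq_two : dist (frame₁ (ρ : ℂ)) (frame₂ (ρ : ℂ)) = 2

/-- Expected rendezvous time when both robots use the strategy `S`, with independent private
randomness, from the placement `P`. -/
def Strategy.expectedTime {ρ : ℝ} (S : Strategy ρ) (P : Placement ρ) : ℝ≥0∞ :=
  ∫⁻ ω : S.Ω × S.Ω,
    meetingTime (fun t => P.frame₁ (S.traj ω.1 t)) (fun t => P.frame₂ (S.traj ω.2 t))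
    ∂(S.law.prod S.law)

/-- An online algorithm for the problem: for each (known) radius `ρ`, a strategy which both
robots follow. -/
def OnlineAlgorithm : Type 1 := ∀ ρ : ℝ, Strategy ρ

namespace OnlineAlgorithm

/-- The (worst case over placements) expected rendezvous time at radius `ρ`. -/
def expectedTime (A : OnlineAlgorithm) (ρ : ℝ) : ℝ≥0∞ :=
  ⨆ P : Placement ρ, (A ρ).expectedTime P

/-- `A` is `c`-competitive: on every instance its expected rendezvous time is at most `c` times
the offline optimum. -/
def IsCompetitive (A : OnlineAlgorithm) (c : ℝ) : Prop :=
  ∀ ρ : ℝ, √2 < ρ → ∀ P : Placement ρ,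
    (A ρ).expectedTime P ≤
      ENNReal.ofReal c * offlineOpt (P.frame₁ (ρ : ℂ)) (P.frame₂ (ρ : ℂ))

/-- The radii at which the expected rendezvous time is no more than `4.25`. -/
def goodRadii (A : OnlineAlgorithm) : Set ℝ :=
  {ρ | √2 < ρ ∧ A.expectedTime ρ ≤ ENNReal.ofReal 4.25}

/-- `A` is `δ`-effective: `δ` is the largest radius at which the expected rendezvous time is
no more than `4.25`, or `δ = 0` if there is no such radius. -/
def IsEffective (A : OnlineAlgorithm) (δ : ℝ) : Prop :=
  IsGreatest A.goodRadii δ ∨ (A.goodRadii = ∅ ∧ δ = 0)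

end OnlineAlgorithm

end SRD

end

/-! Chords of length 2 of the circle of radius ρ form a polygonal path through both starting points,
which are adjacent vertices. Robots confined to it play symmetric rendezvous on a line from distance
2, each with a private, possibly reversed, notion of forward. Accidental meetings elsewhere, where
the path closes up or crosses itself, only help.

The line game is played in independent random blocks of 15 unit steps. The block distribution is
invariant under reversal, so orientations do not matter. A finite computation shows that a block
costs 4.231108 time units in expectation, and that robots fail to meet in it with probability
0.006114, in which case they are again at distance 2 (`gapAfter_block_le_one`). Hence the expected
time satisfies E = 4.231108 + 0.006114 E, which gives about 4.25714. The play is cut off after n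
blocks by walking to the reference point; for n large, depending on ρ, this adds less than the slack
below 4.2574 (`exists_expectedCost_le`).

The offline optimum is at least 1, so 4.2574 bounds the competitive ratio. A deterministic initial
wait raises the worst-case time to exactly 4.2574 at every radius; as this exceeds 4.25, no radius
is good and the algorithm is 0-effective. -/

open MeasureTheory
open scoped NNReal ENNReal
noncomputable section
namespace SRD
/-! ### Words and the gap between the robots

A word is a list of unit steps on a line. Two robots at distance `2 * h` follow one word each;
the letter `true` is a step towards the other robot and `false` is a step away from it. -/

/-- The half-distance after one step, from half-distance `h + 1`. -/
def nextGap (h : ℕ) : Bool → Bool → ℕ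
  | true, true => h
  | true, false => h + 1
  | false, true => h + 1
  | false, false => h + 2

/-- The number of steps until the robots meet or the words end, from half-distance `h`. -/
def duration : List Bool → List Bool → ℕ → ℕ
  | _, _, 0 => 0
  | a :: as, b :: bs, h + 1 => 1 + duration as bs (nextGap h a b)
  | [], _, _ + 1 => 0
  | _ :: _, [], _ + 1 => 0

/-- The half-distance when the robots meet or the words end, from half-distance `h`. -/
def gapAfter : List Bool → List Bool → ℕ → ℕ
  | _, _, 0 => 0
  | a :: as, b :: bs, h + 1 => gapAfter as bs (nextGap h a b)
  | [], _, h + 1 => h + 1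
  | _ :: _, [], h + 1 => h + 1

/-! ### Weighted lists of words -/

/-- The weighted sum of `f` over a weighted list of words. -/
def wsum {R : Type*} [Semiring R] (l : List (ℕ × List Bool)) (f : List Bool → R) : R :=
  (l.map fun p => (p.1 : R) * f p.2).sum

section wsum

variable {R : Type*} [Semiring R]

@[simp]
theorem wsum_nil (f : List Bool → R) : wsum [] f = 0 := rfl

@[simp]
theorem wsum_cons (p : ℕ × List Bool) (l : List (ℕ × List Bool)) (f : List Bool → R) :
    wsum (p :: l) f = p.1 * f p.2 + wsum l f := by
  simp [wsum]

theorem wsum_append (l m : List (ℕ × List Bool)) (f : List Bool → R) :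
    wsum (l ++ m) f = wsum l f + wsum m f := by
  simp [wsum]

theorem wsum_add (l : List (ℕ × List Bool)) (f g : List Bool → R) :
    wsum l (fun a => f a + g a) = wsum l f + wsum l g := by
  induction l with
  | nil => simp
  | cons p l ih => simp only [wsum_cons, ih, mul_add]; abel

theorem wsum_mul_right (l : List (ℕ × List Bool)) (f : List Bool → R) (c : R) :
    wsum l (fun a => f a * c) = wsum l f * c := by
  induction l with
  | nil => simp
  | cons p l ih => simp only [wsum_cons, ih, add_mul, mul_assoc]

theorem wsum_congr {l : List (ℕ × List Bool)} {f g : List Bool → R}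
    (h : ∀ p ∈ l, f p.2 = g p.2) : wsum l f = wsum l g := by
  unfold wsum
  congr 1
  exact List.map_congr_left fun p hp => by rw [h p hp]

theorem wsum_natCast (l : List (ℕ × List Bool)) (f : List Bool → ℕ) :
    ((wsum l f : ℕ) : R) = wsum l fun a => (f a : R) := by
  induction l with
  | nil => simp
  | cons p l ih => simp [ih]

end wsum

theorem wsum_eq_zero {l : List (ℕ × List Bool)} {f : List Bool → ℕ} (h : wsum l f = 0)
    (hl : ∀ p ∈ l, p.1 ≠ 0) : ∀ p ∈ l, f p.2 = 0 := by
  intro p hp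
  have := List.sum_eq_zero_iff.1 h (p.1 * f p.2)
    (List.mem_map.2 ⟨p, hp, by simp⟩)
  exact (mul_eq_zero.1 this).resolve_left (hl p hp)

/-- The words of `l` that start with the letter `a`, with that letter removed. -/
def branch (a : Bool) : List (ℕ × List Bool) → List (ℕ × List Bool)
  | [] => []
  | (_, []) :: l => branch a l
  | (w, b :: as) :: l => bif a == b then (w, as) :: branch a l else branch a l

theorem length_of_mem_branch {a : Bool} {n : ℕ} {l : List (ℕ × List Bool)}
    (hl : ∀ p ∈ l, p.2.length = n + 1) : ∀ p ∈ branch a l, p.2.length = n := by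
  induction l with
  | nil => simp [branch]
  | cons q l ih =>
    have ih := ih fun p hp => hl p (List.mem_cons_of_mem _ hp)
    have hq := hl q List.mem_cons_self
    rcases q with ⟨w, _ | ⟨b, as⟩⟩
    · simpa [branch] using ih
    · intro p hp
      by_cases hab : a = b
      · simp only [branch, hab, beq_self_eq_true, cond_true, List.mem_cons] at hp
        rcases hp with rfl | hp
        · simpa using hq
        · exact ih p (hab ▸ hp)
      · have : (a == b) = false := by simpa using hab
        rw [branch, this] at hp
        exact ih p hp

theorem wsum_eq_branch {R : Type*} [Semiring R] {n : ℕ} {l : List (ℕ × List Bool)}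
    (hl : ∀ p ∈ l, p.2.length = n + 1) (f : List Bool → R) :
    wsum l f = wsum (branch true l) (fun a => f (true :: a)) +
      wsum (branch false l) (fun a => f (false :: a)) := by
  induction l with
  | nil => simp [branch]
  | cons q l ih =>
    have ih := ih fun p hp => hl p (List.mem_cons_of_mem _ hp)
    have hq := hl q List.mem_cons_self
    rcases q with ⟨w, _ | ⟨_ | _, as⟩⟩
    · simp at hq
    · simp only [wsum_cons, branch, ih, show (true == false) = false from rfl, cond_false,
        beq_self_eq_true, cond_true]
      abel
    · simp only [wsum_cons, branch, ih, show (false == true) = false from rfl, cond_false,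
        beq_self_eq_true, cond_true]
      abel

/-- The total weight. -/
def totalWeight : List (ℕ × List Bool) → ℕ
  | [] => 0
  | p :: l => p.1 + totalWeight l

theorem wsum_const {R : Type*} [Semiring R] (l : List (ℕ × List Bool)) (c : R) :
    wsum l (fun _ => c) = totalWeight l * c := by
  induction l with
  | nil => simp [totalWeight]
  | cons p l ih => simp [totalWeight, ih, add_mul]

theorem totalWeight_eq_branch {n : ℕ} {l : List (ℕ × List Bool)}
    (hl : ∀ p ∈ l, p.2.length = n + 1) :
    totalWeight l = totalWeight (branch true l) + totalWeight (branch false l) := by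
  simpa [wsum_const] using wsum_eq_branch hl (fun _ => (1 : ℕ))

theorem wsum_wsum_eq_branch {R : Type*} [Semiring R] {n : ℕ} {l m : List (ℕ × List Bool)}
    (hl : ∀ p ∈ l, p.2.length = n + 1) (hm : ∀ p ∈ m, p.2.length = n + 1)
    (F : List Bool → List Bool → R) :
    wsum l (fun a => wsum m (F a)) =
      ((wsum (branch true l) fun a => wsum (branch true m) fun b => F (true :: a) (true :: b)) +
        wsum (branch true l) fun a => wsum (branch false m) fun b => F (true :: a) (false :: b)) +
      ((wsum (branch false l) fun a => wsum (branch true m) fun b => F (false :: a) (true :: b)) +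
        wsum (branch false l) fun a =>
          wsum (branch false m) fun b => F (false :: a) (false :: b)) := by
  rw [wsum_eq_branch hl]
  simp only [wsum_eq_branch hm, wsum_add]

/-- The weighted sum of `S * duration + g gapAfter` over all pairs of words of length `n`,
computed letter by letter. -/
def pairCost (S : ℕ) (g : ℕ → ℕ) :
    ℕ → ℕ → List (ℕ × List Bool) → List (ℕ × List Bool) → ℕ
  | _, _, [], _ => 0
  | _, _, _, [] => 0
  | _, 0, _, _ => 0
  | 0, h + 1, l, m => totalWeight l * (totalWeight m * g (h + 1))
  | n + 1, h + 1, l, m =>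
    totalWeight l * (totalWeight m * S) +
      ((pairCost S g n h (branch true l) (branch true m) +
        pairCost S g n (h + 1) (branch true l) (branch false m)) +
      (pairCost S g n (h + 1) (branch false l) (branch true m) +
        pairCost S g n (h + 2) (branch false l) (branch false m)))

theorem wsum_zero (l : List (ℕ × List Bool)) : wsum l (fun _ => (0 : ℕ)) = 0 := by
  simp [wsum_const]

/-- Split both lists by first letter: each pair not yet met pays `S` for the step and continues from
the next gap. Common prefixes are treated together, which keeps kernel evaluation over all pairs
feasible. Pairs that have met are dropped, hence the condition on `g 0`. -/
theorem wsum_wsum_eq_pairCost {S : ℕ} {g : ℕ → ℕ} (hg : g 0 = 0) (n h : ℕ)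
    (l m : List (ℕ × List Bool))
    (hl : ∀ p ∈ l, p.2.length = n) (hm : ∀ p ∈ m, p.2.length = n) :
    wsum l (fun a => wsum m fun b => S * duration a b h + g (gapAfter a b h)) =
      pairCost S g n h l m := by
  induction n generalizing h l m with
  | zero =>
    rcases l with _ | ⟨p, l⟩
    · simp [pairCost]
    rcases m with _ | ⟨q, m⟩
    · simp [pairCost, wsum_zero]
    rcases h with _ | h
    · simp [pairCost, duration, gapAfter, hg, wsum_zero]
    rw [pairCost, ← Nat.cast_id (totalWeight (p :: l)), ← wsum_const,
      ← Nat.cast_id (totalWeight (q :: m)), ← wsum_const]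
    · refine wsum_congr fun a ha => wsum_congr fun b hb => ?_
      simp [List.length_eq_zero_iff.1 (hl a ha), List.length_eq_zero_iff.1 (hm b hb), duration,
        gapAfter]
    all_goals simp
  | succ n ih =>
    rcases l with _ | ⟨p, l⟩
    · simp [pairCost]
    rcases m with _ | ⟨q, m⟩
    · simp [pairCost, wsum_zero]
    rcases h with _ | h
    · simp [pairCost, duration, gapAfter, hg, wsum_zero]
    have key (a b : Bool) (l m : List (ℕ × List Bool)) (hl : ∀ p ∈ l, p.2.length = n)
        (hm : ∀ p ∈ m, p.2.length = n) :
        (wsum l fun x => wsum m fun y => S * duration (a :: x) (b :: y) (h + 1) +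
          g (gapAfter (a :: x) (b :: y) (h + 1))) =
        totalWeight l * (totalWeight m * S) + pairCost S g n (nextGap h a b) l m := by
      simp only [← ih _ l m hl hm, duration, gapAfter, mul_add, mul_one, add_assoc,
        wsum_add (R := ℕ), wsum_const, Nat.cast_id]
    have hl' (a : Bool) := length_of_mem_branch (a := a) hl
    have hm' (a : Bool) := length_of_mem_branch (a := a) hm
    rw [wsum_wsum_eq_branch hl hm, key _ _ _ _ (hl' _) (hm' _), key _ _ _ _ (hl' _) (hm' _),
      key _ _ _ _ (hl' _) (hm' _), key _ _ _ _ (hl' _) (hm' _), pairCost,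
      totalWeight_eq_branch hl, totalWeight_eq_branch hm]
    · simp only [nextGap]
      ring
    all_goals simp

/-! ### A block of fifteen steps -/

/-- The word of length `n` whose letters are the binary digits of `k`. -/
def digits : ℕ → ℕ → List Bool
  | 0, _ => []
  | n + 1, k => (k % 2 == 1) :: digits n (k / 2)

/-- Weighted words of length `15`, encoded by their binary digits. -/
def blockTable : List (ℕ × ℕ) :=
  [(5, 497), (4, 579), (3, 617), (3, 1177), (5, 1573), (5, 1667), (8, 1969), (2, 2435),
   (1, 2473), (6, 3269), (6, 3353), (7, 3441), (5, 3529), (7, 3843), (5, 3881), (4, 3973),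
   (3, 4389), (8, 4483), (4, 4521), (3, 4805), (6, 4889), (6, 4977), (2, 5065), (5, 5891),
   (8, 6211), (6, 6249), (3, 6297), (10, 6385), (4, 6825), (4, 6981), (4, 7089), (5, 7205),
   (7, 7299), (9, 7705), (10, 7793), (2, 7881), (1, 8161), (2, 8645), (3, 9161), (4, 9283),
   (4, 9321), (5, 9457), (2, 9897), (2, 10053), (3, 10393), (2, 10789), (3, 10883), (3, 11185),
   (1, 12257), (3, 13509), (4, 13593), (4, 13681), (3, 13769), (3, 14121), (2, 14213), (3, 14305),
   (4, 15107), (3, 15529), (2, 15619), (3, 15685), (3, 15793), (2, 16837), (2, 17137), (4, 17353),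
   (5, 17475), (4, 17513), (5, 17649), (4, 18089), (4, 18245), (3, 18585), (3, 18981), (4, 19075),
   (3, 19377), (3, 20449), (3, 21701), (3, 21785), (3, 21873), (2, 21961), (2, 22313), (2, 22405),
   (4, 23299), (2, 23721), (3, 23877), (2, 23985), (4, 24869), (9, 24963), (5, 25001), (4, 25285),
   (8, 25369), (7, 25457), (1, 26057), (9, 26371), (1, 26409), (1, 26501), (4, 26691), (3, 26729),
   (5, 26865), (3, 27305), (3, 27461), (4, 27685), (6, 27779), (7, 28185), (8, 28273), (1, 28361),
   (5, 28739), (4, 28777), (6, 28825), (8, 28913), (4, 29221), (6, 29315), (2, 29353), (3, 29509),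
   (5, 29617), (3, 30233), (2, 30321), (6, 30917), (6, 31001), (5, 31089), (4, 31177), (1, 31529),
   (2, 31621), (5, 32259), (1, 32325)]

/-- The weighted list of the words of a block: those of the table, in both orientations. -/
def block : List (ℕ × List Bool) :=
  (blockTable.map fun p => (p.1, digits 15 p.2)) ++
    blockTable.map fun p => (p.1, (digits 15 p.2).map not)

theorem length_of_mem_block : ∀ p ∈ block, p.2.length = 15 := by
  decide +kernel

theorem weight_ne_zero_of_mem_block : ∀ p ∈ block, p.1 ≠ 0 := by
  decide +kernel

theorem totalWeight_block : totalWeight block = 1000 := by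
  decide +kernel

/-- Reversal swaps the two halves of the block list. -/
theorem wsum_block_map_not {R : Type*} [Semiring R] (f : List Bool → R) :
    wsum block (fun a => f (a.map not)) = wsum block f := by
  rw [block, wsum_append, wsum_append, add_comm]
  simp [wsum, Function.comp_def]

theorem pairCost_block_duration : pairCost 1 (fun _ => 0) 15 1 block block = 4231108 := by
  decide +kernel

/-- Final gaps turn out to be 0 or 1, so this is the total weight, out of 1000², of the pairs that
fail to meet. -/
theorem pairCost_block_gap : pairCost 0 id 15 1 block block = 6114 := by
  decide +kernel

/-- `Nat.pred` vanishes only at 0 and 1, so a zero sum with positive weights excludes every larger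
final gap. -/
theorem pairCost_block_pred : pairCost 0 Nat.pred 15 1 block block = 0 := by
  decide +kernel


theorem duration_block :
    wsum block (fun a => wsum block fun b => duration a b 1) = 4231108 := by
  simpa [pairCost_block_duration] using wsum_wsum_eq_pairCost (S := 1) (g := fun _ => 0) rfl 15 1
    block block length_of_mem_block length_of_mem_block

theorem gapAfter_block :
    wsum block (fun a => wsum block fun b => gapAfter a b 1) = 6114 := by
  simpa [pairCost_block_gap] using wsum_wsum_eq_pairCost (S := 0) (g := id) rfl 15 1
    block block length_of_mem_block length_of_mem_block

/-- Robots at distance `2` that do not meet during a block are again at distance `2`. -/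
theorem gapAfter_block_le_one {p q : ℕ × List Bool} (hp : p ∈ block) (hq : q ∈ block) :
    gapAfter p.2 q.2 1 ≤ 1 := by
  have h := wsum_wsum_eq_pairCost (S := 0) (g := Nat.pred) rfl 15 1
    block block length_of_mem_block length_of_mem_block
  rw [pairCost_block_pred] at h
  have h₁ := wsum_eq_zero (wsum_eq_zero h weight_ne_zero_of_mem_block p hp)
    weight_ne_zero_of_mem_block q hq
  simp only [zero_mul, zero_add, Nat.pred_eq_sub_one] at h₁
  omega

/-! ### Random words -/

instance : MeasurableSpace (List Bool) := ⊤

instance : DiscreteMeasurableSpace (List Bool) := ⟨fun _ => trivial⟩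

/-- The law of the concatenation of `n` independent random blocks. -/
def wordLaw : ℕ → Measure (List Bool)
  | 0 => Measure.dirac []
  | n + 1 => (block.map fun p => ((p.1 : ℝ≥0∞) / 1000) • (wordLaw n).map (p.2 ++ ·)).sum

theorem lintegral_wordLaw_zero (f : List Bool → ℝ≥0∞) : ∫⁻ a, f a ∂wordLaw 0 = f [] := by
  simp [wordLaw]

theorem lintegral_wordLaw_succ (n : ℕ) (f : List Bool → ℝ≥0∞) :
    ∫⁻ a, f a ∂wordLaw (n + 1) =
      wsum block (fun p => ∫⁻ a, f (p ++ a) ∂wordLaw n) / 1000 := by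
  rw [wordLaw]
  induction block with
  | nil => simp
  | cons p l ih =>
    rw [List.map_cons, List.sum_cons, lintegral_add_measure, ih, wsum_cons, ENNReal.add_div,
      lintegral_smul_measure, lintegral_map (.of_discrete) (.of_discrete), smul_eq_mul,
      ENNReal.mul_div_right_comm]

theorem lintegral_wsum (μ : Measure (List Bool)) (l : List (ℕ × List Bool))
    (F : List Bool → List Bool → ℝ≥0∞) :
    ∫⁻ a, wsum l (fun p => F p a) ∂μ = wsum l fun p => ∫⁻ a, F p a ∂μ := by
  induction l with
  | nil => simp
  | cons p l ih =>
    simp only [wsum_cons]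
    rw [lintegral_add_left .of_discrete, lintegral_const_mul _ .of_discrete, ih]

instance (n : ℕ) : IsProbabilityMeasure (wordLaw n) := by
  induction n with
  | zero => rw [wordLaw]; infer_instance
  | succ n ih =>
    refine ⟨?_⟩
    rw [← lintegral_one, lintegral_wordLaw_succ]
    simp only [lintegral_one, measure_univ, wsum_const, totalWeight_block, mul_one]
    exact ENNReal.div_self (by simp) (by simp)

/-- The symmetry of a single block passes to concatenations; it makes a robot's unknown orientation
harmless. -/
theorem lintegral_wordLaw_map_not (n : ℕ) (f : List Bool → ℝ≥0∞) :
    ∫⁻ a, f (a.map not) ∂wordLaw n = ∫⁻ a, f a ∂wordLaw n := by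
  induction n generalizing f with
  | zero => simp [lintegral_wordLaw_zero]
  | succ n ih =>
    simp only [lintegral_wordLaw_succ, List.map_append]
    have h (p : List Bool) := ih fun a => f (p.map not ++ a)
    simp only [h]
    rw [wsum_block_map_not fun p => ∫⁻ a, f (p ++ a) ∂wordLaw n]

/-- The time until the robots meet, from half-distance `h`, where `T` is the time after the end of
the words at which they meet if they have not met before. -/
def wordCost (T : ℝ≥0∞) : List Bool → List Bool → ℕ → ℝ≥0∞
  | _, _, 0 => 0
  | a :: as, b :: bs, h + 1 => 1 + wordCost T as bs (nextGap h a b)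
  | [], [], _ + 1 => T
  | [], _ :: _, _ + 1 => ⊤
  | _ :: _, [], _ + 1 => ⊤

/-- Restart property: prefixes of equal length end simultaneously, and if the robots have met by
then, the gap is 0 and the second term vanishes. -/
theorem wordCost_append (T : ℝ≥0∞) {p q : List Bool} (hpq : p.length = q.length)
    (a b : List Bool) (h : ℕ) :
    wordCost T (p ++ a) (q ++ b) h = duration p q h + wordCost T a b (gapAfter p q h) := by
  induction p generalizing q h with
  | nil =>
    rw [List.length_nil, eq_comm, List.length_eq_zero_iff] at hpq
    subst hpq
    cases h <;> simp [duration, gapAfter, wordCost]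
  | cons x p ih =>
    rcases q with _ | ⟨y, q⟩
    · simp at hpq
    cases h with
    | zero => simp [duration, gapAfter, wordCost]
    | succ h =>
      simp [duration, gapAfter, wordCost, ih (by simpa using hpq), add_assoc]

/-- The expected time until the robots meet when they follow independent words of `n` blocks
from distance `2`. -/
def expectedCost (T : ℝ≥0∞) (n : ℕ) : ℝ≥0∞ :=
  ∫⁻ a, ∫⁻ b, wordCost T a b 1 ∂wordLaw n ∂wordLaw n

theorem wsum_mono {l : List (ℕ × List Bool)} {f g : List Bool → ℝ≥0∞}
    (h : ∀ p ∈ l, f p.2 ≤ g p.2) : wsum l f ≤ wsum l g := by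
  induction l with
  | nil => simp
  | cons p l ih =>
    simp only [wsum_cons]
    gcongr
    · exact h p List.mem_cons_self
    · exact ih fun p hp => h p (List.mem_cons_of_mem _ hp)

theorem expectedCost_zero (T : ℝ≥0∞) : expectedCost T 0 = T := by
  simp [expectedCost, lintegral_wordLaw_zero, wordCost]

/-- Renewal: condition on the first block of each robot; the remaining blocks are independent of it.
-/
theorem expectedCost_succ_le (T : ℝ≥0∞) (n : ℕ) :
    expectedCost T (n + 1) ≤ (4231108 + 6114 * expectedCost T n) / 1000 / 1000 := by
  calc expectedCost T (n + 1)
      = wsum block (fun p => wsum block fun q => ∫⁻ a, ∫⁻ b,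
          wordCost T (p ++ a) (q ++ b) 1 ∂wordLaw n ∂wordLaw n) / 1000 / 1000 := by
        simp only [expectedCost, lintegral_wordLaw_succ]
        simp only [div_eq_mul_inv]
        congr 1
        rw [← wsum_mul_right]
        refine congrArg _ (funext fun p => ?_)
        rw [lintegral_mul_const _ .of_discrete, lintegral_wsum]
    _ ≤ wsum block (fun p => wsum block fun q => (duration p q 1 : ℝ≥0∞) +
          gapAfter p q 1 * expectedCost T n) / 1000 / 1000 := by
        gcongr
        refine wsum_mono fun p hp => wsum_mono fun q hq => ?_
        have hpq : p.2.length = q.2.length := by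
          rw [length_of_mem_block p hp, length_of_mem_block q hq]
        simp only [wordCost_append T hpq]
        have h := gapAfter_block_le_one hp hq
        generalize gapAfter p.2 q.2 1 = g at h
        simp only [lintegral_add_left Measurable.of_discrete, lintegral_const, measure_univ,
          mul_one]
        gcongr
        -- Gap 0: the robots have met and pay nothing more. Gap 1: the game restarts with `n`
        -- blocks.
        interval_cases g
        · simp [wordCost]
        · simp [expectedCost]
    _ = _ := by
        simp only [wsum_add, wsum_mul_right, ← wsum_natCast, duration_block, gapAfter_block]
        norm_cast

/-- The recursion contracts towards its fixed point, about 4.25714, which 4.2572 rounds up; 0.1 is a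
crude bound for the factor 0.006114. -/
theorem expectedCost_le (T : ℝ≥0∞) (n : ℕ) :
    expectedCost T n ≤ ENNReal.ofReal 4.2572 + T * ENNReal.ofReal 0.1 ^ n := by
  induction n with
  | zero => simp [expectedCost_zero]
  | succ n ih =>
    refine (expectedCost_succ_le T n).trans ?_
    have h1 : (1000 : ℝ≥0∞)⁻¹ = ENNReal.ofReal 0.001 := by
      rw [← ENNReal.ofReal_ofNat, ← ENNReal.ofReal_inv_of_pos (by norm_num)]
      norm_num
    have h2 (k : ℕ) [k.AtLeastTwo] : (OfNat.ofNat k : ℝ≥0∞) = ENNReal.ofReal (OfNat.ofNat k) :=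
      (ENNReal.ofReal_ofNat k).symm
    calc (4231108 + 6114 * expectedCost T n) / 1000 / 1000
        ≤ (4231108 + 6114 * (ENNReal.ofReal 4.2572 + T * ENNReal.ofReal 0.1 ^ n))
            / 1000 / 1000 := by gcongr
      _ = (4231108 + 6114 * ENNReal.ofReal 4.2572) * 1000⁻¹ * 1000⁻¹ +
            T * ENNReal.ofReal 0.1 ^ n * (6114 * 1000⁻¹ * 1000⁻¹) := by
          simp only [div_eq_mul_inv]
          ring
      _ ≤ ENNReal.ofReal 4.2572 + T * ENNReal.ofReal 0.1 ^ n * ENNReal.ofReal 0.1 := by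
          rw [h1, h2 4231108, h2 6114, ← ENNReal.ofReal_mul (by norm_num),
            ← ENNReal.ofReal_add (by norm_num) (by norm_num), ← ENNReal.ofReal_mul (by norm_num),
            ← ENNReal.ofReal_mul (by norm_num), ← ENNReal.ofReal_mul (by norm_num),
            ← ENNReal.ofReal_mul (by norm_num)]
          gcongr <;> norm_num
      _ = _ := by rw [pow_succ, mul_assoc]

/-- With enough blocks, the final phase does not matter. -/
theorem exists_expectedCost_le {T : ℝ≥0∞} (hT : T ≠ ⊤) :
    ∃ n, expectedCost T n ≤ ENNReal.ofReal 4.2574 := by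
  have h : Filter.Tendsto (fun n => ENNReal.ofReal 4.2572 + T * ENNReal.ofReal 0.1 ^ n)
      Filter.atTop (nhds (ENNReal.ofReal 4.2572 + T * 0)) := by
    refine tendsto_const_nhds.add (ENNReal.Tendsto.const_mul ?_ (.inr hT))
    refine ENNReal.tendsto_pow_atTop_nhds_zero_of_lt_one ?_
    rw [ENNReal.ofReal_lt_one]
    norm_num
  have h' : ENNReal.ofReal 4.2572 + T * 0 < ENNReal.ofReal 4.2574 := by
    rw [mul_zero, add_zero, ENNReal.ofReal_lt_ofReal_iff] <;> norm_num
  obtain ⟨n, hn⟩ := (h.eventually_lt_const h').exists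
  exact ⟨n, (expectedCost_le T n).trans hn.le⟩

/-! ### Polygonal trajectories -/

/-- The trajectory that visits `u 0, …, u M` at times `0, …, M` along straight segments
and then stays at `u M`. -/
def polygonal (u : ℕ → ℂ) (M : ℕ) (t : ℝ≥0) : ℂ :=
  u 0 + ∑ n ∈ Finset.range M, ((min 1 (t - n) : ℝ≥0) : ℝ) • (u (n + 1) - u n)

/-- By truncated subtraction the n-th term is the time spent on the n-th segment up to time `t`. -/
theorem sum_min_one_tsub (M : ℕ) (t : ℝ≥0) :
    ∑ n ∈ Finset.range M, min 1 (t - n) = min t M := by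
  induction M with
  | zero => simp
  | succ M ih =>
    rw [Finset.sum_range_succ, ih]
    rcases le_total t M with h | h
    · rw [tsub_eq_zero_of_le h, min_eq_left h, min_eq_right zero_le_one, add_zero, min_eq_left]
      exact h.trans (by simp)
    · obtain ⟨s, rfl⟩ := exists_add_of_le h
      rw [add_tsub_cancel_left, min_eq_right h, Nat.cast_succ, min_add_add_left, min_comm]

/-- The time spent on each segment is monotone in `t`, so the triangle inequality bounds the
displacement by the increment of the total time in motion. -/
theorem isTrajectory_polygonal {u : ℕ → ℂ} (hu : ∀ n, ‖u (n + 1) - u n‖ ≤ 1) (M : ℕ) :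
    IsTrajectory (polygonal u M) := by
  have key : ∀ s t : ℝ≥0, s ≤ t → dist (polygonal u M s) (polygonal u M t) ≤ dist s t := by
    intro s t hst
    have hsum (t : ℝ≥0) : ∑ n ∈ Finset.range M, ((min 1 (t - n) : ℝ≥0) : ℝ) = min (t : ℝ) M := by
      rw [← NNReal.coe_sum, sum_min_one_tsub, NNReal.coe_min, NNReal.coe_natCast]
    calc dist (polygonal u M s) (polygonal u M t)
        = ‖∑ n ∈ Finset.range M, (((min 1 (t - n) : ℝ≥0) : ℝ) - ((min 1 (s - n) : ℝ≥0) : ℝ)) •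
            (u (n + 1) - u n)‖ := by
          rw [dist_comm, dist_eq_norm, polygonal, polygonal, add_sub_add_left_eq_sub,
            ← Finset.sum_sub_distrib]
          simp only [sub_smul]
      _ ≤ ∑ n ∈ Finset.range M, (((min 1 (t - n) : ℝ≥0) : ℝ) - ((min 1 (s - n) : ℝ≥0) : ℝ)) := by
          refine (norm_sum_le _ _).trans (Finset.sum_le_sum fun n _ => ?_)
          have h : ((min 1 (s - n) : ℝ≥0) : ℝ) ≤ ((min 1 (t - n) : ℝ≥0) : ℝ) :=
            NNReal.coe_le_coe.2 (min_le_min_left _ (tsub_le_tsub_right hst _))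
          rw [norm_smul, Real.norm_of_nonneg (sub_nonneg.2 h)]
          exact mul_le_of_le_one_right (sub_nonneg.2 h) (hu n)
      _ = min (t : ℝ) M - min (s : ℝ) M := by rw [Finset.sum_sub_distrib, hsum, hsum]
      _ ≤ t - s := by
          have : (s : ℝ) ≤ t := hst
          rcases le_total (t : ℝ) M with h | h
          · rw [min_eq_left h, min_eq_left (this.trans h)]
          · rw [min_eq_right h]
            rcases le_total (s : ℝ) M with h' | h'
            · rw [min_eq_left h']; linarith
            · rw [min_eq_right h']; linarith
      _ ≤ dist s t := by
          rw [dist_comm, NNReal.dist_eq]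
          exact le_abs_self _
  refine LipschitzWith.of_dist_le_mul fun s t => ?_
  rw [NNReal.coe_one, one_mul]
  rcases le_total s t with h | h
  · exact key s t h
  · rw [dist_comm, dist_comm s]
    exact key t s h

theorem polygonal_natCast {u : ℕ → ℂ} {m M : ℕ} (h : m ≤ M) : polygonal u M m = u m := by
  have h₁ : ∀ n ∈ Finset.range M, ((min 1 ((m : ℝ≥0) - n) : ℝ≥0) : ℝ) • (u (n + 1) - u n) =
      if n < m then u (n + 1) - u n else 0 := by
    intro n _
    split_ifs with hn
    · have : (1 : ℝ≥0) ≤ m - n := by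
        rw [← Nat.cast_tsub]
        exact_mod_cast Nat.sub_pos_of_lt hn
      simp [min_eq_left this]
    · have : (m : ℝ≥0) - n = 0 := tsub_eq_zero_of_le (by exact_mod_cast not_lt.1 hn)
      simp [this]
  have h₂ : (Finset.range M).filter (· < m) = Finset.range m := by
    ext n
    simp only [Finset.mem_filter, Finset.mem_range]
    omega
  rw [polygonal, Finset.sum_congr rfl h₁, ← Finset.sum_filter, h₂, Finset.sum_range_sub]
  ring

theorem polygonal_zero (u : ℕ → ℂ) (M : ℕ) : polygonal u M 0 = u 0 := by
  simpa using polygonal_natCast (u := u) (Nat.zero_le M)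

/-! ### The polygon of chords of length two -/

/-- The even points are the vertices of the polygon with vertices `ρ * ζ ^ k`, and the odd points
are the midpoints of its edges. -/
def chordPoint (ρ : ℝ) (ζ : ℂ) (n : ℤ) : ℂ := ρ * (ζ ^ (n / 2) + ζ ^ ((n + 1) / 2)) / 2

section chordPoint

variable {ρ : ℝ} {ζ : ℂ}

theorem chordPoint_zero : chordPoint ρ ζ 0 = ρ := by
  norm_num [chordPoint]

theorem chordPoint_add_two (hζ : ‖ζ‖ = 1) (n : ℤ) :
    chordPoint ρ ζ (n + 2) = ζ * chordPoint ρ ζ n := by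
  have h0 : ζ ≠ 0 := by rintro rfl; simp at hζ
  have h1 : (n + 2) / 2 = n / 2 + 1 := by omega
  have h2 : (n + 2 + 1) / 2 = (n + 1) / 2 + 1 := by omega
  rw [chordPoint, chordPoint, h1, h2, zpow_add_one₀ h0, zpow_add_one₀ h0]
  ring

theorem chordPoint_neg (hζ : ‖ζ‖ = 1) (n : ℤ) :
    chordPoint ρ ζ (-n) = (starRingEnd ℂ) (chordPoint ρ ζ n) := by
  have h1 : -n / 2 = -((n + 1) / 2) := by omega
  have h2 : (-n + 1) / 2 = -(n / 2) := by omega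
  have h3 : (starRingEnd ℂ) ζ = ζ⁻¹ := (Complex.inv_eq_conj hζ).symm
  rw [chordPoint, chordPoint, h1, h2]
  simp only [map_div₀, map_mul, map_add, map_zpow₀, h3, Complex.conj_ofReal, zpow_neg, inv_zpow,
    map_ofNat]
  ring

theorem norm_chordPoint_le (hρ : 0 < ρ) (hζ : ‖ζ‖ = 1) (n : ℤ) : ‖chordPoint ρ ζ n‖ ≤ ρ := by
  have h : ‖ζ ^ (n / 2) + ζ ^ ((n + 1) / 2)‖ ≤ 2 := by
    refine (norm_add_le _ _).trans_eq ?_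
    rw [norm_zpow, norm_zpow, hζ, one_zpow, one_zpow]
    norm_num
  rw [chordPoint, norm_div, norm_mul, Complex.norm_real, Real.norm_of_nonneg hρ.le,
    Complex.norm_ofNat]
  nlinarith

theorem norm_chordPoint_succ_sub (hρ : 0 < ρ) (hζ : ‖ζ‖ = 1) (h2 : ρ * ‖ζ - 1‖ = 2) (n : ℤ) :
    ‖chordPoint ρ ζ (n + 1) - chordPoint ρ ζ n‖ = 1 := by
  have h0 : ζ ≠ 0 := by rintro rfl; simp at hζ
  have h1 : (n + 1 + 1) / 2 = n / 2 + 1 := by omega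
  have : chordPoint ρ ζ (n + 1) - chordPoint ρ ζ n = ζ ^ (n / 2) * (ρ * (ζ - 1)) / 2 := by
    rw [chordPoint, chordPoint, h1, zpow_add_one₀ h0]
    ring
  rw [this, norm_div, norm_mul, norm_mul, norm_zpow, hζ, one_zpow, Complex.norm_real,
    Real.norm_of_nonneg hρ.le, h2, Complex.norm_ofNat]
  norm_num

/-- `1` or `-1`. -/
def sign (s : Bool) : ℤ := bif s then 1 else -1

/-- A linear isometry of the plane is a rotation, possibly after conjugation, and conjugation
reverses the direction of travel along the polygon. -/
theorem exists_frame_chordPoint (hζ : ‖ζ‖ = 1) (f : ℂ ≃ₗᵢ[ℝ] ℂ) :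
    ∃ (c : ℂ) (s : Bool), ‖c‖ = 1 ∧ ∀ n, f (chordPoint ρ ζ n) = c * chordPoint ρ ζ (sign s * n) := by
  obtain ⟨c, rfl | rfl⟩ := linear_isometry_complex f
  · exact ⟨c, true, Circle.norm_coe c, fun n => by simp [sign]⟩
  · exact ⟨c, false, Circle.norm_coe c, fun n => by simp [sign, chordPoint_neg hζ]⟩

/-- On the unit circle the distance to 1 determines the real part, hence the point up to
conjugation. -/
theorem eq_or_eq_inv_of_norm_sub_one {w : ℂ} (hζ : ‖ζ‖ = 1) (hw : ‖w‖ = 1)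
    (h : ‖w - 1‖ = ‖ζ - 1‖) : w = ζ ∨ w = ζ⁻¹ := by
  have h1 : w.re * w.re + w.im * w.im = 1 := by
    rw [← Complex.normSq_apply, Complex.normSq_eq_norm_sq, hw, one_pow]
  have h2 : ζ.re * ζ.re + ζ.im * ζ.im = 1 := by
    rw [← Complex.normSq_apply, Complex.normSq_eq_norm_sq, hζ, one_pow]
  have h3 : (w.re - 1) * (w.re - 1) + w.im * w.im = (ζ.re - 1) * (ζ.re - 1) + ζ.im * ζ.im := by
    have := congrArg (· ^ 2) h
    simpa [← Complex.normSq_eq_norm_sq, Complex.normSq_apply] using this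
  have hre : w.re = ζ.re := by linarith
  have him : (w.im - ζ.im) * (w.im + ζ.im) = 0 := by rw [hre] at h1; linarith
  rw [Complex.inv_eq_conj hζ]
  rcases mul_eq_zero.1 him with h | h
  · exact .inl (Complex.ext hre (by linarith))
  · exact .inr (Complex.ext hre (by rw [Complex.conj_im]; linarith))

theorem exists_chord (hρ : 1 ≤ ρ) : ∃ ζ : ℂ, ‖ζ‖ = 1 ∧ ρ * ‖ζ - 1‖ = 2 := by
  have h0 : 0 < ρ := by linarith
  -- The real part is forced: ‖ζ - 1‖² = 2 - 2 re ζ must equal 4 / ρ².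
  set x : ℝ := 1 - 2 / ρ ^ 2 with hx
  have hx1 : x ≤ 1 := by rw [hx]; linarith [show 0 ≤ 2 / ρ ^ 2 by positivity]
  have hx2 : -1 ≤ x := by
    have : 2 / ρ ^ 2 ≤ 2 := div_le_self (by norm_num) (one_le_pow₀ hρ)
    linarith
  have hy : √(1 - x ^ 2) * √(1 - x ^ 2) = 1 - x ^ 2 := Real.mul_self_sqrt (by nlinarith)
  refine ⟨⟨x, √(1 - x ^ 2)⟩, ?_, ?_⟩
  · rw [Complex.norm_def, Complex.normSq_apply, hy]
    simp [← pow_two]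
  · have : ‖(⟨x, √(1 - x ^ 2)⟩ : ℂ) - 1‖ = 2 / ρ := by
      rw [Complex.norm_def, Complex.normSq_apply]
      simp only [Complex.sub_re, Complex.sub_im, Complex.one_re, Complex.one_im, sub_zero, hy]
      rw [Real.sqrt_eq_iff_mul_self_eq (by nlinarith) (by positivity), hx]
      field_simp
      ring
    rw [this]
    field_simp

/-- In suitable orientations, two robots that together have moved `2` towards each other along
the polygon are at the same point. -/
theorem Placement.exists_sign (P : Placement ρ) (hρ : 0 < ρ) (hζ : ‖ζ‖ = 1)
    (h2 : ρ * ‖ζ - 1‖ = 2) :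
    ∃ s₁ s₂ : Bool, ∀ m n : ℤ, sign s₁ * m + sign s₂ * n = 2 →
      P.frame₁ (chordPoint ρ ζ m) = P.frame₂ (chordPoint ρ ζ n) := by
  obtain ⟨c₁, s₁, hc₁, h₁⟩ := exists_frame_chordPoint (ρ := ρ) hζ P.frame₁
  obtain ⟨c₂, s₂, hc₂, h₂⟩ := exists_frame_chordPoint (ρ := ρ) hζ P.frame₂
  have h0 : ζ ≠ 0 := by rintro rfl; simp at hζ
  have hc₀ : c₁ ≠ 0 := by rintro rfl; simp at hc₁
  have hneg (s : Bool) : sign (!s) = -sign s := by cases s <;> rfl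
  have hd := P.dist_eq_two
  have e₁ := h₁ 0
  have e₂ := h₂ 0
  rw [mul_zero, chordPoint_zero] at e₁ e₂
  have hw : ‖c₂ / c₁ - 1‖ = ‖ζ - 1‖ := by
    rw [e₁, e₂, dist_comm, dist_eq_norm, ← sub_mul, norm_mul, Complex.norm_real,
      Real.norm_of_nonneg hρ.le] at hd
    rw [div_sub_one hc₀, norm_div, hc₁, div_one]
    exact mul_right_cancel₀ hρ.ne' (by linarith)
  -- The second robot starts one vertex after or one vertex before the first; the robot with the
  -- larger index must decrease it to approach, so its sign is flipped.
  rcases eq_or_eq_inv_of_norm_sub_one hζ (by rw [norm_div, hc₁, hc₂, div_one]) hw with h | h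
  · rw [div_eq_iff hc₀] at h
    refine ⟨s₁, !s₂, fun m n hmn => ?_⟩
    rw [hneg] at hmn
    rw [h₁, h₂, h, show sign s₁ * m = sign s₂ * n + 2 by linarith, chordPoint_add_two hζ]
    ring
  · rw [div_eq_iff hc₀, eq_inv_mul_iff_mul_eq₀ h0] at h
    refine ⟨!s₁, s₂, fun m n hmn => ?_⟩
    rw [hneg] at hmn
    rw [h₁, h₂, ← h, show sign s₂ * n = sign s₁ * m + 2 by linarith, chordPoint_add_two hζ]
    ring

theorem Placement.nonempty (hρ : 1 ≤ ρ) : Nonempty (Placement ρ) := by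
  obtain ⟨ζ, hζ, h2⟩ := exists_chord hρ
  obtain ⟨c, rfl⟩ : ∃ c : Circle, (c : ℂ) = ζ := ⟨⟨ζ, mem_sphere_zero_iff_norm.2 hζ⟩, rfl⟩
  refine ⟨⟨.refl ℝ ℂ, rotation c, ?_⟩⟩
  rw [rotation_apply, LinearIsometryEquiv.coe_refl, id, dist_comm, dist_eq_norm,
    ← sub_one_mul, norm_mul, Complex.norm_real, Real.norm_of_nonneg (by linarith), mul_comm]
  exact h2

end chordPoint

/-! ### The strategy -/

/-- The displacement along the polygon after the steps of a word. -/
def displacement : List Bool → ℤ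
  | [] => 0
  | a :: as => sign a + displacement as

theorem displacement_map_not (a : List Bool) :
    displacement (a.map not) = -displacement a := by
  induction a with
  | nil => rfl
  | cons x a ih => cases x <;> simp [displacement, sign, ih] <;> ring

theorem displacement_take_succ {a : List Bool} {n : ℕ} (h : n < a.length) :
    displacement (a.take (n + 1)) = displacement (a.take n) + 1 ∨
      displacement (a.take n) = displacement (a.take (n + 1)) + 1 := by
  induction a generalizing n with
  | nil => simp at h
  | cons x a ih =>
    cases n with
    | zero => cases x <;> simp [displacement, sign]
    | succ n =>
      have := ih (n := n) (by simpa using h)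
      simp only [List.take_succ_cons, displacement]
      omega

/-- Makes the cost geometric: a distance of 2h is closed when the displacements towards each other
add up to 2h. The value `⊤` takes care of words of unequal length. -/
theorem wordCost_cases (T : ℝ≥0∞) (a b : List Bool) (h : ℕ) :
    wordCost T a b h = ⊤ ∨
    (∃ n ≤ a.length, n ≤ b.length ∧
      displacement (a.take n) + displacement (b.take n) = 2 * h ∧ wordCost T a b h = n) ∨
    (a.length = b.length ∧ wordCost T a b h = a.length + T) := by
  induction a generalizing b h with
  | nil =>
    rcases h with _ | h
    · exact .inr (.inl ⟨0, by simp [displacement, wordCost]⟩)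
    rcases b with _ | ⟨y, b⟩ <;> simp [wordCost]
  | cons x a ih =>
    rcases h with _ | h
    · exact .inr (.inl ⟨0, by simp [displacement, wordCost]⟩)
    rcases b with _ | ⟨y, b⟩
    · simp [wordCost]
    rcases ih b (nextGap h x y) with ih | ⟨n, hna, hnb, hn, ih⟩ | ⟨hl, ih⟩
    · exact .inl (by rw [wordCost, ih, add_top])
    · refine .inr (.inl ⟨n + 1, by simpa using hna, by simpa using hnb, ?_, ?_⟩)
      · simp only [List.take_succ_cons, displacement]
        cases x <;> cases y <;> simp only [nextGap] at hn <;> push_cast at hn ⊢ <;>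
          simp [sign] <;> linarith
      · rw [wordCost, ih, Nat.cast_succ, add_comm]
    · refine .inr (.inr ⟨by simpa using hl, ?_⟩)
      rw [wordCost, ih, List.length_cons, Nat.cast_succ]
      ring

/-- A robot walks along the polygon according to a word and then goes to the reference point in
`⌈ρ⌉₊` units of time; this is its position at integer times. -/
def itinerary (ρ : ℝ) (ζ : ℂ) (a : List Bool) (n : ℕ) : ℂ :=
  chordPoint ρ ζ (displacement (a.take n)) * (1 - ((n - a.length : ℕ) : ℂ) / ⌈ρ⌉₊)

section itinerary

variable {ρ : ℝ} {ζ : ℂ} (a : List Bool)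

theorem itinerary_of_le {n : ℕ} (h : n ≤ a.length) :
    itinerary ρ ζ a n = chordPoint ρ ζ (displacement (a.take n)) := by
  simp [itinerary, Nat.sub_eq_zero_of_le h]

theorem itinerary_zero : itinerary ρ ζ a 0 = ρ := by
  rw [itinerary_of_le a (Nat.zero_le _), List.take_zero, displacement, chordPoint_zero]

theorem itinerary_end (hρ : 0 < ρ) : itinerary ρ ζ a (a.length + ⌈ρ⌉₊) = 0 := by
  have : (⌈ρ⌉₊ : ℂ) ≠ 0 := by exact_mod_cast (Nat.ceil_pos.2 hρ).ne'
  simp [itinerary, div_self this]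

theorem norm_itinerary_succ_sub_le (hρ : 0 < ρ) (hζ : ‖ζ‖ = 1) (h2 : ρ * ‖ζ - 1‖ = 2) (n : ℕ) :
    ‖itinerary ρ ζ a (n + 1) - itinerary ρ ζ a n‖ ≤ 1 := by
  rcases lt_or_ge n a.length with h | h
  · rw [itinerary_of_le a h.le, itinerary_of_le a (Nat.succ_le_of_lt h)]
    rcases displacement_take_succ h with h | h
    · rw [h, norm_chordPoint_succ_sub hρ hζ h2]
    · rw [norm_sub_rev, h, norm_chordPoint_succ_sub hρ hζ h2]
  -- On the way to the reference point each unit of time covers the fraction 1 / ⌈ρ⌉₊ of a segment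
  -- of length at most ρ.
  · have hR : 0 < (⌈ρ⌉₊ : ℝ) := by exact_mod_cast Nat.ceil_pos.2 hρ
    have : itinerary ρ ζ a (n + 1) - itinerary ρ ζ a n =
        -(chordPoint ρ ζ (displacement a) / ⌈ρ⌉₊) := by
      rw [itinerary, itinerary, List.take_of_length_le h, List.take_of_length_le (by omega),
        Nat.succ_sub h, Nat.cast_succ]
      ring
    rw [this, norm_neg, norm_div, Complex.norm_natCast, div_le_one hR]
    exact (norm_chordPoint_le hρ hζ _).trans (Nat.le_ceil ρ)

end itinerary

/-- Walk along the polygon for `n` random blocks, then go to the reference point. -/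
def walkStrategy (ρ : ℝ) (hρ : 0 < ρ) (ζ : ℂ) (hζ : ‖ζ‖ = 1) (h2 : ρ * ‖ζ - 1‖ = 2) (n : ℕ) :
    Strategy ρ where
  Ω := List Bool
  law := wordLaw n
  traj a := polygonal (itinerary ρ ζ a) (a.length + ⌈ρ⌉₊)
  isTrajectory a := isTrajectory_polygonal (norm_itinerary_succ_sub_le a hρ hζ h2) _
  start a := by rw [polygonal_zero, itinerary_zero]
  measurable _ := .of_discrete

theorem meetingTime_le {γ₁ γ₂ : ℝ≥0 → ℂ} {t : ℝ≥0} (h : γ₁ t = γ₂ t) :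
    meetingTime γ₁ γ₂ ≤ t :=
  iInf₂_le t h

/-- The word `a` or the word with all steps reversed. -/
def orient (s : Bool) (a : List Bool) : List Bool := bif s then a else a.map not

theorem displacement_take_orient (s : Bool) (a : List Bool) (n : ℕ) :
    displacement ((orient s a).take n) = sign s * displacement (a.take n) := by
  cases s
  · simp [orient, sign, ← List.map_take, displacement_map_not]
  · simp [orient, sign]

theorem length_orient (s : Bool) (a : List Bool) : (orient s a).length = a.length := by
  cases s <;> simp [orient]

theorem lintegral_wordLaw_orient (s : Bool) (n : ℕ) (f : List Bool → ℝ≥0∞) :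
    ∫⁻ a, f (orient s a) ∂wordLaw n = ∫⁻ a, f a ∂wordLaw n := by
  cases s
  · exact lintegral_wordLaw_map_not n f
  · rfl

/-- Once oriented by the signs of the placement, the words say towards or away from the partner, so
the line game bounds the meeting time pathwise. If the words run out, the robots meet at the
reference point. -/
theorem expectedTime_walkStrategy_le {ρ : ℝ} (hρ : 0 < ρ) {ζ : ℂ} (hζ : ‖ζ‖ = 1)
    (h2 : ρ * ‖ζ - 1‖ = 2) (n : ℕ) (P : Placement ρ) :
    (walkStrategy ρ hρ ζ hζ h2 n).expectedTime P ≤ expectedCost ⌈ρ⌉₊ n := by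
  obtain ⟨s₁, s₂, hs⟩ := P.exists_sign hρ hζ h2
  set γ : List Bool → ℝ≥0 → ℂ := (walkStrategy ρ hρ ζ hζ h2 n).traj with hγ
  have hγ_nat (a : List Bool) {m : ℕ} (hm : m ≤ a.length + ⌈ρ⌉₊) :
      γ a m = itinerary ρ ζ a m := polygonal_natCast hm
  have key (a b : List Bool) : meetingTime (fun t => P.frame₁ (γ a t))
      (fun t => P.frame₂ (γ b t)) ≤ wordCost ⌈ρ⌉₊ (orient s₁ a) (orient s₂ b) 1 := by
    rcases wordCost_cases ⌈ρ⌉₊ (orient s₁ a) (orient s₂ b) 1 with h | ⟨m, ha, hb, hm, h⟩ | ⟨hl, h⟩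
    · exact h ▸ le_top
    · rw [h]
      rw [length_orient] at ha hb
      rw [displacement_take_orient, displacement_take_orient] at hm
      have : P.frame₁ (γ a m) = P.frame₂ (γ b m) := by
        rw [hγ_nat a (by omega), hγ_nat b (by omega), itinerary_of_le a ha, itinerary_of_le b hb]
        exact hs _ _ (by simpa using hm)
      exact_mod_cast meetingTime_le this
    · rw [length_orient, length_orient] at hl
      rw [h, length_orient]
      have : P.frame₁ (γ a ((a.length + ⌈ρ⌉₊ : ℕ) : ℝ≥0)) =
          P.frame₂ (γ b ((a.length + ⌈ρ⌉₊ : ℕ) : ℝ≥0)) := by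
        rw [hγ_nat a le_rfl, hγ_nat b (by omega), itinerary_end a hρ, hl, itinerary_end b hρ,
          map_zero, map_zero]
      exact_mod_cast meetingTime_le this
  calc (walkStrategy ρ hρ ζ hζ h2 n).expectedTime P
      ≤ ∫⁻ ω : List Bool × List Bool, wordCost ⌈ρ⌉₊ (orient s₁ ω.1) (orient s₂ ω.2) 1
          ∂((wordLaw n).prod (wordLaw n)) := lintegral_mono fun ω => key ω.1 ω.2
    _ = ∫⁻ a, ∫⁻ b, wordCost ⌈ρ⌉₊ (orient s₁ a) (orient s₂ b) 1 ∂wordLaw n ∂wordLaw n :=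
        lintegral_prod _ (Measurable.of_discrete).aemeasurable
    _ = expectedCost ⌈ρ⌉₊ n := by
        -- Reversal invariance removes the signs, so the bound no longer depends on the placement.
        have h (a : List Bool) := lintegral_wordLaw_orient s₂ n
          fun b => wordCost ⌈ρ⌉₊ (orient s₁ a) b 1
        simp only [h]
        exact lintegral_wordLaw_orient s₁ n fun a => ∫⁻ b, wordCost ⌈ρ⌉₊ a b 1 ∂wordLaw n

theorem exists_strategy {ρ : ℝ} (hρ : 1 ≤ ρ) :
    ∃ S : Strategy ρ, ∀ P : Placement ρ, S.expectedTime P ≤ ENNReal.ofReal 4.2574 := by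
  have h0 : 0 < ρ := by linarith
  obtain ⟨ζ, hζ, h2⟩ := exists_chord hρ
  obtain ⟨n, hn⟩ := exists_expectedCost_le (ENNReal.natCast_ne_top ⌈ρ⌉₊)
  exact ⟨walkStrategy ρ h0 ζ hζ h2 n,
    fun P => (expectedTime_walkStrategy_le h0 hζ h2 n P).trans hn⟩

/-! ### Waiting before the walk -/

/-- Wait for time `d` and then follow the strategy. -/
def Strategy.delay {ρ : ℝ} (S : Strategy ρ) (d : ℝ≥0) : Strategy ρ where
  Ω := S.Ω
  law := S.law
  traj ω t := S.traj ω (t - d)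
  isTrajectory ω := by
    refine LipschitzWith.of_dist_le_mul fun s t => ?_
    refine ((S.isTrajectory ω).dist_le_mul _ _).trans ?_
    gcongr
    rw [NNReal.dist_eq, NNReal.dist_eq, NNReal.coe_sub_def, NNReal.coe_sub_def]
    refine (abs_max_sub_max_le_abs _ _ _).trans_eq ?_
    congr 1
    ring
  start ω := by rw [zero_tsub]; exact S.start ω
  measurable t := S.measurable (t - d)

/-- Distinct starting points rule out a meeting during the wait, so the shift is exact and not
merely an upper bound. -/
theorem meetingTime_delay {γ₁ γ₂ : ℝ≥0 → ℂ} (h : γ₁ 0 ≠ γ₂ 0) (d : ℝ≥0) :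
    meetingTime (fun t => γ₁ (t - d)) (fun t => γ₂ (t - d)) = d + meetingTime γ₁ γ₂ := by
  apply le_antisymm
  · simp only [meetingTime, ENNReal.add_iInf]
    refine le_iInf₂ fun t ht => ?_
    refine (iInf₂_le (d + t) ?_).trans_eq (by rw [ENNReal.coe_add])
    simpa using ht
  · refine le_iInf₂ fun t ht => ?_
    have hd : d ≤ t := by
      by_contra hlt
      beta_reduce at ht
      rw [tsub_eq_zero_of_le (not_le.1 hlt).le] at ht
      exact h ht
    calc (d : ℝ≥0∞) + meetingTime γ₁ γ₂ ≤ d + (t - d : ℝ≥0) := by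
          gcongr
          exact meetingTime_le ht
      _ = t := by rw [← ENNReal.coe_add, add_tsub_cancel_of_le hd]

theorem Strategy.expectedTime_delay {ρ : ℝ} (S : Strategy ρ) (d : ℝ≥0) (P : Placement ρ) :
    (S.delay d).expectedTime P = d + S.expectedTime P := by
  have hP : P.frame₁ (ρ : ℂ) ≠ P.frame₂ (ρ : ℂ) := by
    intro h
    have := P.dist_eq_two
    rw [h, dist_self] at this
    norm_num at this
  calc (S.delay d).expectedTime P
      = ∫⁻ ω : S.Ω × S.Ω, (d + meetingTime (fun t => P.frame₁ (S.traj ω.1 t))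
          (fun t => P.frame₂ (S.traj ω.2 t))) ∂(S.law.prod S.law) := by
        refine lintegral_congr fun (ω : S.Ω × S.Ω) => ?_
        exact meetingTime_delay (γ₁ := fun t => P.frame₁ (S.traj ω.1 t))
          (γ₂ := fun t => P.frame₂ (S.traj ω.2 t)) (by rwa [S.start, S.start]) d
    _ = _ := by
        rw [lintegral_add_left measurable_const, lintegral_const, measure_univ, mul_one]
        rfl

/-- Waiting spends the part of the time budget that the walk does not need. -/
theorem exists_strategy_iSup_eq {ρ : ℝ} (hρ : 1 ≤ ρ) :
    ∃ S : Strategy ρ, ⨆ P : Placement ρ, S.expectedTime P = ENNReal.ofReal 4.2574 := by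
  obtain ⟨S, hS⟩ := exists_strategy hρ
  have := Placement.nonempty hρ
  have hle := iSup_le hS
  obtain ⟨d, hd⟩ : ∃ d : ℝ≥0, ENNReal.ofReal 4.2574 - (⨆ P, S.expectedTime P) = d :=
    ⟨_, (ENNReal.coe_toNNReal (ENNReal.sub_ne_top ENNReal.ofReal_ne_top)).symm⟩
  refine ⟨S.delay d, ?_⟩
  simp only [S.expectedTime_delay]
  rw [← ENNReal.add_iSup, ← hd, tsub_add_cancel_of_le hle]

/-! ### The offline lower bound and a default strategy -/

theorem one_le_offlineOpt {p q : ℂ} (h : dist p q = 2) : 1 ≤ offlineOpt p q := by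
  refine le_iInf fun γ₁ => le_iInf fun γ₂ => le_iInf fun h₁ => le_iInf fun h₂ =>
    le_iInf fun t => le_iInf fun ht => ?_
  have e₁ := h₁.1.dist_le_mul 0 t
  have e₂ := h₂.1.dist_le_mul 0 t
  rw [h₁.2, NNReal.dist_eq, NNReal.coe_one, one_mul, NNReal.coe_zero, zero_sub, abs_neg,
    NNReal.abs_eq] at e₁
  rw [h₂.2, NNReal.dist_eq, NNReal.coe_one, one_mul, NNReal.coe_zero, zero_sub, abs_neg,
    NNReal.abs_eq] at e₂
  have h3 := dist_triangle_right p q (γ₁ t)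
  rw [h] at h3
  rw [ht] at h3 e₁
  have : (1 : ℝ) ≤ t := by linarith
  exact_mod_cast this

/-- Stay at the starting point. -/
def stayStrategy (ρ : ℝ) : Strategy ρ where
  Ω := Unit
  law := Measure.dirac ()
  traj _ _ := ρ
  isTrajectory _ := LipschitzWith.const' (K := 1) (ρ : ℂ)
  start _ := rfl
  measurable _ := measurable_const

end SRD

end

/-- The algorithm waits until the rest of the time budget is what the walk along the polygon of
chords of length `2` needs. Its worst-case expected time is exactly `4.2574` at every radius. -/
theorem mainTheorem10 :
    ∃ A : SRD.OnlineAlgorithm, A.IsCompetitive 4.2574 ∧ A.IsEffective 0 := by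
  have h (ρ : ℝ) : ∃ S : SRD.Strategy ρ, √2 < ρ →
      ⨆ P : SRD.Placement ρ, S.expectedTime P = ENNReal.ofReal 4.2574 := by
    by_cases hρ : √2 < ρ
    · have h1 : (1 : ℝ) ≤ √2 := Real.one_le_sqrt.2 (by norm_num)
      obtain ⟨S, hS⟩ := SRD.exists_strategy_iSup_eq (h1.trans hρ.le)
      exact ⟨S, fun _ => hS⟩
    -- An algorithm needs some strategy at every real ρ; outside the range of the problem any will
    -- do.
    · exact ⟨SRD.stayStrategy ρ, fun h => absurd h hρ⟩
  choose A hA using h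
  refine ⟨A, fun ρ hρ P => ?_, .inr ⟨Set.eq_empty_iff_forall_notMem.2 ?_, rfl⟩⟩
  · calc (A ρ).expectedTime P ≤ ENNReal.ofReal 4.2574 * 1 := by
          rw [mul_one, ← hA ρ hρ]
          exact le_iSup (A ρ).expectedTime P
      _ ≤ _ := by
          gcongr
          exact SRD.one_le_offlineOpt P.dist_eq_two
  -- A good radius would force 4.2574 ≤ 4.25; this needs the exact worst-case value that the waiting
  -- provides.
  · rintro ρ ⟨hρ, hle⟩
    change ⨆ P : SRD.Placement ρ, (A ρ).expectedTime P ≤ _ at hle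
    rw [hA ρ hρ,
      ENNReal.ofReal_le_ofReal_iff (by norm_num)] at hle
    norm_num at hle
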